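/- All C*-algebras are complex. Let $\mathcal X,\mathcal Y$ be classes of unital C*-algebras closed under isomorphism (the zero algebra counts as a unital C*-algebra). A unital C*-algebra $A$ is called $\mathcal X$-$\mathcal Y$ projective if for all $B\in\mathcal X$, $M\in\mathcal Y$, every surjective unital $*$-homomorphism $\pi:B\to M$ and every unital $*$-homomorphism $\varphi:A\to M$ there is a unital $*$-homomorphism $\psi:A\to B$ with $\pi\circ\psi=\varphi$. It is called C*-$\mathcal Y$ projective if it is $\mathcal X$-$\mathcal Y$ projective with $\mathcal X$ the class of all unital C*-algebras; it is C*-W* projective (C*-AW* projective) if moreover $\mathcal Y$ is the class of all von Neumann algebras (of all AW*-algebras). Here a von Neumann algebra is a C*-algebra that is $*$-isomorphic to a $*$-algebra of bounded operators on a Hilbert space which equals its double commutant, and a unital C*-algebra is an AW*-algebra if every set of projections in it has a least upper bound among its projections and every maximal abelian selfadjoint subalgebra is the C*-algebra generated by its projections. Let $K$ be a compact metric space, and let $C(K)$ be the C*-algebra of continuous complex-valued functions on $K$. The following are equivalent (the empty space is not regarded as connected): 1. $C(K)$ is C*-W* projective; 2. $C(K)$ is C*-AW* projective; 3. $C(K)$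 is C*-$\mathcal Y$ projective, where $\mathcal Y$ is the class of all unital C*-algebras in which every commutative separable C*-subalgebra is contained in a commutative C*-subalgebra generated by projections; 4. $K$ is a continuous image of $[0,1]$; 5. $K$ is connected and locally path-connected; 6. every continuous function from a closed subset of $[0,1]$ into $K$ can be extended to a continuous function from $[0,1]$ into $K$; 7. every continuous function from a closed subset of the Cantor set (in $[0,1]$) into $K$ can be extended to a continuous function from $[0,1]$ into $K$. -/

import Mathlib

universe u v

/-- Unital `𝒳`-`𝒴` projectivity of a unital C⋆-algebra `A`: every unital `⋆`-homomorphism from `A`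
to an algebra `M` in `𝒴` lifts along every unital surjective `⋆`-homomorphism `B → M` with `B` in
`𝒳`. Homomorphisms `→⋆ₐ[ℂ]` are unital; the zero algebra is a (unital) C⋆-algebra. -/
def IsProjectiveFor (𝒳 𝒴 : ∀ (B : Type v) [CStarAlgebra B], Prop)
    (A : Type u) [CStarAlgebra A] : Prop :=
  ∀ (B M : Type v) [CStarAlgebra B] [CStarAlgebra M], 𝒳 B → 𝒴 M →
    ∀ π : B →⋆ₐ[ℂ] M, Function.Surjective π →
      ∀ φ : A →⋆ₐ[ℂ] M, ∃ ψ : A →⋆ₐ[ℂ] B, π.comp ψ = φ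

/-- The class of all unital C⋆-algebras. -/
def AnyCStar (B : Type v) [CStarAlgebra B] : Prop := True

/-- The class of von Neumann algebras, closed under isomorphism: C⋆-algebras `⋆`-isomorphic to a
`⋆`-algebra of bounded operators on some Hilbert space that equals its double commutant. -/
def IsVonNeumann (M : Type v) [CStarAlgebra M] : Prop :=
  ∃ (H : Type v) (_ : NormedAddCommGroup H) (_ : InnerProductSpace ℂ H) (_ : CompleteSpace H)
    (N : VonNeumannAlgebra H), Nonempty (M ≃⋆ₐ[ℂ] N.toStarSubalgebra)

/-- `q` is the least upper bound of the set `S` of projections in the poset of projections,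
where `p ≤ q` means `p * q = p`. -/
def IsProjectionLUB {M : Type v} [CStarAlgebra M] (S : Set M) (q : M) : Prop :=
  IsStarProjection q ∧ (∀ p ∈ S, p * q = p) ∧
    ∀ r : M, IsStarProjection r → (∀ p ∈ S, p * r = p) → q * r = q

/-- The elements of the `⋆`-subalgebra `D` commute with each other. -/
def IsCommutativeSubalg {M : Type v} [CStarAlgebra M] (D : NonUnitalStarSubalgebra ℂ M) : Prop :=
  ∀ x ∈ D, ∀ y ∈ D, x * y = y * x

/-- `D` is the (norm-closed) C⋆-subalgebra generated by the projections that it contains. -/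
def IsGeneratedByProjections {M : Type v} [CStarAlgebra M]
    (D : NonUnitalStarSubalgebra ℂ M) : Prop :=
  D = (NonUnitalStarAlgebra.adjoin ℂ {p : M | p ∈ D ∧ IsStarProjection p}).topologicalClosure

/-- AW⋆-algebras: every set of projections has a least upper bound, and every maximal abelian
selfadjoint subalgebra is the C⋆-algebra generated by its projections. -/
def IsAWStar (M : Type v) [CStarAlgebra M] : Prop :=
  (∀ S : Set M, (∀ p ∈ S, IsStarProjection p) → ∃ q : M, IsProjectionLUB S q) ∧
    ∀ D : NonUnitalStarSubalgebra ℂ M, Maximal IsCommutativeSubalg D → IsGeneratedByProjections D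

/-- The class of unital C⋆-algebras in which every commutative separable C⋆-subalgebra is contained
in a commutative C⋆-subalgebra generated by projections. -/
def HasEnoughProjections (M : Type v) [CStarAlgebra M] : Prop :=
  ∀ A : NonUnitalStarSubalgebra ℂ M, IsClosed (A : Set M) →
    TopologicalSpace.IsSeparable (A : Set M) → IsCommutativeSubalg A →
      ∃ D : NonUnitalStarSubalgebra ℂ M,
        IsCommutativeSubalg D ∧ IsGeneratedByProjections D ∧ A ≤ D

/-! Projectivity against von Neumann algebras is tested on the bounded functions on a countable
discrete set `S`. They are a quotient of the continuous functions on the cube whose coordinates are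
indexed by all maps `S → [0,1]`. Lifting the homomorphism dual to a dense sequence of `K` gives a
map from this cube onto `K`, so `K` is connected and locally path-connected
(`connected_locallyPathConnected_of_isProjectiveFor`). In such a `K`, paths that are short for close
endpoints fill the gaps of a closed subset of `[0,1]`, which gives the extension property
(`exists_extension_unitInterval`).

Conversely, if `M` has enough projections, the image of `φ : C(K) → M` lies in a commutative algebra
generated by countably many projections `p n`. The element `∑ 3⁻ⁿ p n` separates characters, so the
spectrum embeds in `[0,1]`. The extension property then turns `φ` into `f ↦ (f ∘ G)(a)` with `a`
self-adjoint and `G` defined on all of `ℂ` (`exists_starAlgHom_eq_cfc`). Self-adjoint elements lift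
along surjections, hence so does `φ` (`exists_lift_of_eq_cfc`).

The three classes of algebras are nested: annihilator projections make von Neumann algebras AW⋆, and
a maximal commutative subalgebra supplies enough projections in an AW⋆-algebra. Extending a
surjection from the Cantor set closes the remaining cycle. -/

section

open Set Filter Topology WeakDual
open scoped BoundedContinuousFunction CStarAlgebra

/-! ### Continuous images, cubes and small paths -/

/-- The quotient of a locally path-connected space by a continuous surjection from a compact space
onto a Hausdorff space is locally path-connected. -/
theorem locallyPathConnectedSpace_of_surjective {X Y : Type*} [TopologicalSpace X]
    [TopologicalSpace Y] [CompactSpace X] [T2Space Y] [LocallyPathConnectedSpace X]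
    (f : C(X, Y)) (hf : Function.Surjective f) : LocallyPathConnectedSpace Y :=
  (f.continuous.isClosedMap.isQuotientMap f.continuous hf).locallyPathConnectedSpace

theorem connectedSpace_of_surjective {X Y : Type*} [TopologicalSpace X]
    [TopologicalSpace Y] [ConnectedSpace X]
    (f : C(X, Y)) (hf : Function.Surjective f) : ConnectedSpace Y :=
  hf.connectedSpace f.continuous

/-- Coordinatewise clamping retracts `J → ℝ` onto the cube, and a retraction is a quotient map. The
index set is arbitrary because an uncountable cube is needed later. -/
instance unitInterval.cube_locallyPathConnectedSpace (J : Type*) :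
    LocallyPathConnectedSpace (J → unitInterval) := by
  have hs : Continuous fun (x : J → unitInterval) j => (x j : ℝ) := by fun_prop
  have hr : Continuous fun (x : J → ℝ) j => projIcc (0 : ℝ) 1 zero_le_one (x j) :=
    continuous_pi fun j => continuous_projIcc.comp (continuous_apply j)
  refine (IsQuotientMap.of_inverse hs hr ?_).locallyPathConnectedSpace
  intro x
  funext j
  exact projIcc_val zero_le_one (x j)

/-- In a compact locally path-connected metric space, close points are joined by small paths. -/
theorem exists_small_joining_path {K : Type*} [MetricSpace K] [CompactSpace K]
    [LocallyPathConnectedSpace K] {ε : ℝ} (hε : 0 < ε) :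
    ∃ δ > 0, ∀ p q : K, dist p q < δ → ∃ γ : Path p q, ∀ t, dist (γ t) p ≤ ε := by
  have h : ∀ x : K, ∃ U ∈ 𝓝 x, IsPathConnected U ∧ U ⊆ Metric.ball x (ε / 2) := fun x => by
    obtain ⟨U, ⟨hU, hp⟩, hs⟩ :=
      (path_connected_basis x).mem_iff.1 (Metric.ball_mem_nhds x (half_pos hε))
    exact ⟨U, hU, hp, hs⟩
  choose U hU hp hs using h
  obtain ⟨δ, hδ, H⟩ := lebesgue_number_lemma_of_metric (s := (univ : Set K)) isCompact_univ
    (c := fun x => interior (U x)) (fun _ => isOpen_interior)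
    (fun x _ => mem_iUnion.2 ⟨x, mem_interior_iff_mem_nhds.2 (hU x)⟩)
  refine ⟨δ, hδ, fun p q hpq => ?_⟩
  obtain ⟨x, hx⟩ := H p (mem_univ p)
  have hpU := interior_subset (hx (Metric.mem_ball_self hδ))
  have hqU := interior_subset (hx (Metric.mem_ball'.2 hpq))
  have hj := (hp x).joinedIn p hpU q hqU
  refine ⟨hj.somePath, fun t => ?_⟩
  have h1 := Metric.mem_ball.1 (hs x (hj.somePath_mem t))
  have h2 := Metric.mem_ball.1 (hs x hpU)
  have := dist_triangle_right (hj.somePath t) p x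
  linarith

/-- A choice of paths between all pairs of points, which are small for close points. -/
theorem exists_small_path_system (K : Type*) [MetricSpace K] [CompactSpace K] [ConnectedSpace K]
    [LocallyPathConnectedSpace K] :
    ∃ γ : ∀ p q : K, Path p q, ∀ ε > 0, ∃ δ > 0, ∀ p q : K, dist p q < δ →
      ∀ t, dist (γ p q t) p < ε := by
  have hpc : PathConnectedSpace K := pathConnectedSpace_iff_connectedSpace.2 inferInstance
  -- A nearly optimal path: its radius exceeds any attainable one by at most `dist p q`, so a single
  -- choice serves every `ε`. For `p = q` there is no slack, but the constant path is optimal.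
  have h : ∀ p q : K, ∃ γ : Path p q, ∀ r : ℝ, (∃ γ' : Path p q, ∀ t, dist (γ' t) p ≤ r) →
      ∀ t, dist (γ t) p ≤ r + dist p q := by
    intro p q
    rcases eq_or_ne p q with rfl | hne
    · refine ⟨Path.refl p, fun r ⟨γ', h⟩ t => ?_⟩
      simpa using dist_nonneg.trans (h 0)
    · let R : Set ℝ := {r | ∃ γ' : Path p q, ∀ t, dist (γ' t) p ≤ r}
      have hR : R.Nonempty := by
        obtain ⟨γ⟩ := PathConnectedSpace.joined p q
        exact ⟨Metric.diam univ, γ, fun t =>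
          Metric.dist_le_diam_of_mem isCompact_univ.isBounded (mem_univ _) (mem_univ _)⟩
      have hb : BddBelow R := ⟨0, fun r ⟨γ', h⟩ => dist_nonneg.trans (h 0)⟩
      obtain ⟨r, ⟨γ, hγ⟩, hr⟩ := exists_lt_of_csInf_lt hR
        (lt_add_of_pos_right (sInf R) (dist_pos.2 hne))
      refine ⟨γ, fun s hs t => (hγ t).trans ?_⟩
      have := csInf_le hb hs
      linarith
  choose γ hγ using h
  refine ⟨γ, fun ε hε => ?_⟩
  obtain ⟨δ, hδ, H⟩ := exists_small_joining_path (K := K) (half_pos hε)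
  refine ⟨min δ (ε / 2), lt_min hδ (half_pos hε), fun p q hpq t => ?_⟩
  have h1 := hγ p q (ε / 2) (H p q (hpq.trans_le (min_le_left _ _))) t
  have h2 := hpq.trans_le (min_le_right _ _)
  linarith

/-! ### Extension across the gaps of a closed subset of the line -/

/-- The greatest point of `E` below `y`. -/
noncomputable def lowerPoint (E : Set ℝ) (y : ℝ) : ℝ := sSup (E ∩ Iic y)

/-- The least point of `E` above `y`. -/
noncomputable def upperPoint (E : Set ℝ) (y : ℝ) : ℝ := sInf (E ∩ Ici y)

theorem isGreatest_lowerPoint {E : Set ℝ} (hE : IsClosed E) {e y : ℝ} (he : e ∈ E) (hy : e ≤ y) :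
    IsGreatest (E ∩ Iic y) (lowerPoint E y) :=
  (hE.inter isClosed_Iic).isGreatest_csSup ⟨e, he, hy⟩ ⟨y, fun _ h => h.2⟩

theorem isLeast_upperPoint {E : Set ℝ} (hE : IsClosed E) {e y : ℝ} (he : e ∈ E) (hy : y ≤ e) :
    IsLeast (E ∩ Ici y) (upperPoint E y) :=
  (hE.inter isClosed_Ici).isLeast_csInf ⟨e, he, hy⟩ ⟨y, fun _ h => h.2⟩

theorem lowerPoint_eq_self {E : Set ℝ} {y : ℝ} (hy : y ∈ E) : lowerPoint E y = y :=
  IsGreatest.csSup_eq ⟨⟨hy, mem_Iic.2 le_rfl⟩, fun _ h => h.2⟩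

theorem upperPoint_eq_self {E : Set ℝ} {y : ℝ} (hy : y ∈ E) : upperPoint E y = y :=
  IsLeast.csInf_eq ⟨⟨hy, mem_Ici.2 le_rfl⟩, fun _ h => h.2⟩

theorem lowerPoint_eq_of_gap {E : Set ℝ} {l r y : ℝ} (hl : l ∈ E) (hgap : ∀ e ∈ E, e ∉ Ioo l r)
    (hy : y ∈ Ioo l r) : lowerPoint E y = l :=
  IsGreatest.csSup_eq ⟨⟨hl, hy.1.le⟩, fun e h => not_lt.1 fun hle =>
    hgap e h.1 ⟨hle, h.2.trans_lt hy.2⟩⟩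

theorem upperPoint_eq_of_gap {E : Set ℝ} {l r y : ℝ} (hr : r ∈ E) (hgap : ∀ e ∈ E, e ∉ Ioo l r)
    (hy : y ∈ Ioo l r) : upperPoint E y = r :=
  IsLeast.csInf_eq ⟨⟨hr, hy.2.le⟩, fun e h => not_lt.1 fun hle =>
    hgap e h.1 ⟨hy.1.trans_le h.2, hle⟩⟩

/-- The extension of `F` from `E` to the convex hull of `E` by the paths `γ` in the gaps. -/
noncomputable def gapExtension {K : Type*} [TopologicalSpace K] (γ : ∀ p q : K, Path p q)
    (E : Set ℝ) (F : ℝ → K) (y : ℝ) : K :=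
  (γ (F (lowerPoint E y)) (F (upperPoint E y))).extend
    ((y - lowerPoint E y) / (upperPoint E y - lowerPoint E y))

/-- Both gap endpoints equal `y`, so the parameter is `0 / 0 = 0` and the path sits at its source;
`γ p p` need not be constant. -/
theorem gapExtension_eq {K : Type*} [TopologicalSpace K] (γ : ∀ p q : K, Path p q)
    {E : Set ℝ} (F : ℝ → K) {y : ℝ} (hy : y ∈ E) : gapExtension γ E F y = F y := by
  simp [gapExtension, lowerPoint_eq_self hy, upperPoint_eq_self hy]

theorem continuousOn_gapExtension_gap {K : Type*} [TopologicalSpace K] (γ : ∀ p q : K, Path p q)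
    {E : Set ℝ} (F : ℝ → K) {l r : ℝ} (hl : l ∈ E) (hr : r ∈ E) (hlr : l < r)
    (hgap : ∀ e ∈ E, e ∉ Ioo l r) : ContinuousOn (gapExtension γ E F) (Icc l r) := by
  have hc : Continuous fun y => (γ (F l) (F r)).extend ((y - l) / (r - l)) :=
    (Path.continuous_extend _).comp (by fun_prop)
  refine hc.continuousOn.congr fun y hy => ?_
  rcases hy.1.eq_or_lt with rfl | h1
  · simp [gapExtension_eq γ F hl]
  rcases hy.2.eq_or_lt with rfl | h2
  · simp [gapExtension_eq γ F hr, div_self (sub_pos.2 hlr).ne']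
  rw [gapExtension, lowerPoint_eq_of_gap hl hgap ⟨h1, h2⟩,
    upperPoint_eq_of_gap hr hgap ⟨h1, h2⟩]

/-- Off `E` a single path governs. At a point of `E` each side is treated separately: it either
borders a gap or is a limit of points of `E`, where the gap paths become short. -/
theorem continuousOn_gapExtension {K : Type*} [MetricSpace K] (γ : ∀ p q : K, Path p q)
    (hγ : ∀ ε > 0, ∃ δ > 0, ∀ p q : K, dist p q < δ → ∀ t, dist (γ p q t) p < ε)
    {E : Set ℝ} (hE : IsClosed E) {F : ℝ → K} (hF : ContinuousOn F E) {m M : ℝ} (hm : m ∈ E)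
    (hM : M ∈ E) : ContinuousOn (gapExtension γ E F) (Icc m M) := by
  intro x hx
  by_cases hxE : x ∈ E
  swap
  · have h1 := isGreatest_lowerPoint hE hm hx.1
    have h2 := isLeast_upperPoint hE hM hx.2
    have h1' : lowerPoint E x < x := lt_of_le_of_ne h1.1.2 fun h => hxE (h ▸ h1.1.1)
    have h2' : x < upperPoint E x := lt_of_le_of_ne h2.1.2 fun h => hxE (h ▸ h2.1.1)
    refine ((continuousOn_gapExtension_gap γ F h1.1.1 h2.1.1 (h1'.trans h2') ?_).continuousAt
      (Icc_mem_nhds h1' h2')).continuousWithinAt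
    intro e he hlr
    rcases le_total e x with h | h
    · exact (h1.2 ⟨he, h⟩).not_gt hlr.1
    · exact (h2.2 ⟨he, h⟩).not_gt hlr.2
  -- If `y` is squeezed between points of `E` near `x`, so are the endpoints of its gap; their
  -- images are close and the path joining them is short.
  have key : ∀ ε > 0, ∃ η > 0, ∀ a ∈ E, ∀ b ∈ E, dist a x < η → dist b x < η → ∀ y ∈ Icc a b,
      dist (gapExtension γ E F y) (gapExtension γ E F x) < ε := by
    intro ε hε
    obtain ⟨δ, hδ, H⟩ := hγ (ε / 2) (half_pos hε)
    obtain ⟨η, hη, h⟩ := Metric.continuousWithinAt_iff.1 (hF x hxE) (min (ε / 2) (δ / 2))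
      (lt_min (half_pos hε) (half_pos hδ))
    refine ⟨η, hη, fun a ha b hb hax hbx y hy => ?_⟩
    have h1 := isGreatest_lowerPoint hE ha hy.1
    have h2 := isLeast_upperPoint hE hb hy.2
    have hl1 : a ≤ lowerPoint E y := h1.2 ⟨ha, hy.1⟩
    have hl2 : lowerPoint E y ≤ y := h1.1.2
    have hr1 : y ≤ upperPoint E y := h2.1.2
    have hr2 : upperPoint E y ≤ b := h2.2 ⟨hb, hy.2⟩
    have hab := hy.1.trans hy.2
    rw [Real.dist_eq, abs_lt] at hax hbx
    have hL := h h1.1.1 (by rw [Real.dist_eq, abs_lt]; constructor <;> linarith)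
    have hR := h h2.1.1 (by rw [Real.dist_eq, abs_lt]; constructor <;> linarith)
    have hLR : dist (F (lowerPoint E y)) (F (upperPoint E y)) < δ := by
      have := dist_triangle_right (F (lowerPoint E y)) (F (upperPoint E y)) (F x)
      have := min_le_right (ε / 2) (δ / 2)
      linarith
    have hg : dist (gapExtension γ E F y) (F (lowerPoint E y)) < ε / 2 := H _ _ hLR _
    rw [gapExtension_eq γ F hxE]
    have := dist_triangle (gapExtension γ E F y) (F (lowerPoint E y)) (F x)
    have := min_le_left (ε / 2) (δ / 2)
    linarith
  have right : ContinuousWithinAt (gapExtension γ E F) (Icc x M) x := by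
    rcases hx.2.eq_or_lt with rfl | hxM
    · simp [continuousWithinAt_singleton]
    by_cases hz : ∃ z > x, ∀ e ∈ E, e ∉ Ioo x z
    · obtain ⟨z, hxz, hz⟩ := hz
      obtain ⟨y, hy1, hy2⟩ := exists_between (lt_min hxz hxM)
      have hyz := hy2.trans_le (min_le_left _ _)
      have h2 := isLeast_upperPoint hE hM (hy2.trans_le (min_le_right _ _)).le
      have hxr : x < upperPoint E y := hy1.trans_le h2.1.2
      refine (((continuousOn_gapExtension_gap γ F hxE h2.1.1 hxr ?_) x
        (left_mem_Icc.2 hxr.le)).mono_of_mem_nhdsWithin (Icc_mem_nhdsGE hxr)).mono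
        Icc_subset_Ici_self
      intro e he hlr
      rcases le_or_gt y e with h | h
      · exact (h2.2 ⟨he, h⟩).not_gt hlr.2
      · exact hz e he ⟨hlr.1, h.trans hyz⟩
    · push Not at hz
      refine Metric.continuousWithinAt_iff.2 fun ε hε => ?_
      obtain ⟨η, hη, H⟩ := key ε hε
      obtain ⟨e, he, hxe⟩ := hz (x + η) (by linarith)
      refine ⟨e - x, sub_pos.2 hxe.1, fun y hy hyx => H x hxE e he (by simpa) ?_ y ⟨hy.1, ?_⟩⟩
      · rw [Real.dist_eq, abs_lt]; constructor <;> linarith [hxe.1, hxe.2]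
      · rw [Real.dist_eq, abs_lt] at hyx; linarith
  have left : ContinuousWithinAt (gapExtension γ E F) (Icc m x) x := by
    rcases hx.1.eq_or_lt with rfl | hxM
    · simp [continuousWithinAt_singleton]
    by_cases hz : ∃ z < x, ∀ e ∈ E, e ∉ Ioo z x
    · obtain ⟨z, hxz, hz⟩ := hz
      obtain ⟨y, hy1, hy2⟩ := exists_between (max_lt hxz hxM)
      have hyz := (le_max_left _ _).trans_lt hy1
      have h2 := isGreatest_lowerPoint hE hm ((le_max_right _ _).trans_lt hy1).le
      have hxr : lowerPoint E y < x := h2.1.2.trans_lt hy2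
      refine (((continuousOn_gapExtension_gap γ F h2.1.1 hxE hxr ?_) x
        (right_mem_Icc.2 hxr.le)).mono_of_mem_nhdsWithin (Icc_mem_nhdsLE hxr)).mono
        Icc_subset_Iic_self
      intro e he hlr
      rcases le_or_gt e y with h | h
      · exact (h2.2 ⟨he, h⟩).not_gt hlr.1
      · exact hz e he ⟨hyz.trans h, hlr.2⟩
    · push Not at hz
      refine Metric.continuousWithinAt_iff.2 fun ε hε => ?_
      obtain ⟨η, hη, H⟩ := key ε hε
      obtain ⟨e, he, hxe⟩ := hz (x - η) (by linarith)
      refine ⟨x - e, sub_pos.2 hxe.2, fun y hy hyx => H e he x hxE ?_ (by simpa) y ⟨?_, hy.2⟩⟩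
      · rw [Real.dist_eq, abs_lt]; constructor <;> linarith [hxe.1, hxe.2]
      · rw [Real.dist_eq, abs_lt] at hyx; linarith
  rw [← Icc_union_Icc_eq_Icc hx.1 hx.2]
  exact left.union right

/-- Maps from closed subsets of `[0,1]` into a compact, connected, locally path-connected metric
space extend to `[0,1]`. -/
theorem exists_extension_unitInterval {K : Type*} [MetricSpace K] [CompactSpace K]
    [ConnectedSpace K] [LocallyPathConnectedSpace K] {E : Set unitInterval} (hE : IsClosed E)
    (f : C(E, K)) : ∃ g : C(unitInterval, K), ∀ x : E, g x = f x := by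
  rcases E.eq_empty_or_nonempty with rfl | hne
  · obtain ⟨k⟩ : Nonempty K := inferInstance
    exact ⟨ContinuousMap.const _ k, fun x => x.2.elim⟩
  obtain ⟨γ, hγ⟩ := exists_small_path_system K
  obtain ⟨m, hm⟩ := hE.isCompact.exists_isLeast hne
  obtain ⟨M, hM⟩ := hE.isCompact.exists_isGreatest hne
  have hmM : m ≤ M := hm.2 hM.1
  let E' : Set ℝ := Subtype.val '' E
  have hE' : IsClosed E' := (hE.isCompact.image continuous_subtype_val).isClosed
  classical
  -- The default value is immaterial: on `[m, M]` the extension evaluates `F` only at points of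
  -- `E'`.
  let F : ℝ → K := fun y =>
    if h : ∃ z : E, ((z : unitInterval) : ℝ) = y then f h.choose else f ⟨m, hm.1⟩
  have hF : ∀ z : E, F z = f z := fun z => by
    have h : ∃ w : E, ((w : unitInterval) : ℝ) = z := ⟨z, rfl⟩
    simp only [F, dif_pos h]
    congr 1
    exact Subtype.ext (Subtype.ext h.choose_spec)
  have hFc : ContinuousOn F E' := by
    have hemb : IsClosedEmbedding fun z : E => ((z : unitInterval) : ℝ) :=
      (isClosed_Icc.isClosedEmbedding_subtypeVal).comp hE.isClosedEmbedding_subtypeVal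
    have hr : range (fun z : E => ((z : unitInterval) : ℝ)) = E' := by
      ext y; simp [E']
    rw [← hr, ← image_univ]
    refine hemb.isInducing.continuousOn_image_iff.2 ?_
    exact (f.continuous.congr fun z => (hF z).symm).continuousOn
  have hg := continuousOn_gapExtension γ hγ hE' hFc (mem_image_of_mem _ hm.1)
    (mem_image_of_mem _ hM.1)
  have hmM' : (m : ℝ) ≤ M := hmM
  -- Clamping to `[m, M]` extends the map by constants beyond the extreme points of `E`.
  refine ⟨⟨fun y => gapExtension γ E' F (projIcc (m : ℝ) M hmM' y), ?_⟩, fun x => ?_⟩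
  · exact hg.comp_continuous
      (continuous_subtype_val.comp (continuous_projIcc.comp continuous_subtype_val))
      fun y => (projIcc (m : ℝ) M hmM' y).2
  · have hx : ((x : unitInterval) : ℝ) ∈ Icc (m : ℝ) M := ⟨hm.2 x.2, hM.2 x.2⟩
    simp only [ContinuousMap.coe_mk, projIcc_of_mem hmM' hx]
    rw [gapExtension_eq γ F (mem_image_of_mem _ x.2), hF]

/-! ### The Cantor set -/

/-- Extension from the Cantor set gives a continuous surjection from `[0,1]`. -/
theorem exists_surjective_of_cantorSet_extension {K : Type*} [MetricSpace K] [CompactSpace K]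
    (H : ∀ E : Set unitInterval, IsClosed E → (∀ x ∈ E, (x : ℝ) ∈ cantorSet) →
      ∀ f : C(E, K), ∃ g : C(unitInterval, K), ∀ x : E, g x = f x) :
    ∃ f : C(unitInterval, K), Function.Surjective f := by
  -- Extending the empty map already produces a point of `K`.
  have hne : Nonempty K := by
    obtain ⟨g, -⟩ := H ∅ isClosed_empty (by simp) ⟨fun x => x.2.elim, by fun_prop⟩
    exact ⟨g 0⟩
  obtain ⟨s, hs, hsurj⟩ := exists_nat_bool_continuous_surjective_of_compact K
  let E : Set unitInterval := {x | (x : ℝ) ∈ cantorSet}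
  let c : E → K := fun x => s (cantorSetHomeomorphNatToBool ⟨x, x.2⟩)
  obtain ⟨g, hg⟩ := H E (isClosed_cantorSet.preimage continuous_subtype_val) (fun _ h => h)
    ⟨c, hs.comp (cantorSetHomeomorphNatToBool.continuous.comp (by fun_prop))⟩
  refine ⟨g, fun k => ?_⟩
  obtain ⟨b, rfl⟩ := hsurj k
  let z := cantorSetHomeomorphNatToBool.symm b
  refine ⟨⟨z, cantorSet_subset_unitInterval z.2⟩, ?_⟩
  rw [hg ⟨⟨z, cantorSet_subset_unitInterval z.2⟩, z.2⟩]
  simp [c, z]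

/-! ### Annihilator projections in von Neumann algebras -/

/-- Every set of elements has the same left annihilator as some projection. -/
def HasAnnihilatorProjections (M : Type v) [CStarAlgebra M] : Prop :=
  ∀ T : Set M, ∃ q : M, IsStarProjection q ∧ ∀ w : M, (∀ u ∈ T, w * u = 0) ↔ w * q = 0

/-- If `g` commutes with `T`, then `(1 - q) * g` annihilates `T`, hence `q`, so `g * q = q * g * q`.
The same for `star g`, after taking adjoints, gives `q * g = q * g * q`. -/
theorem commute_annihilatorProjection {R : Type*} [Ring R] [StarRing R] {T : Set R} {q : R}
    (hq : IsStarProjection q) (h : ∀ w : R, (∀ u ∈ T, w * u = 0) ↔ w * q = 0) {g : R}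
    (hg : ∀ u ∈ T, g * u = u * g) (hg' : ∀ u ∈ T, star g * u = u * star g) : g * q = q * g := by
  have hT : ∀ u ∈ T, (1 - q) * u = 0 :=
    (h (1 - q)).2 (by rw [sub_mul, one_mul, hq.isIdempotentElem.eq, sub_self])
  have key : ∀ g : R, (∀ u ∈ T, g * u = u * g) → g * q = q * g * q := fun g hg => by
    have := (h ((1 - q) * g)).1 fun u hu => by
      rw [mul_assoc, hg u hu, ← mul_assoc, hT u hu, zero_mul]
    rwa [sub_mul, sub_mul, one_mul, sub_eq_zero] at this
  have h2 := congr_arg star (key (star g) hg')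
  simp only [star_mul, star_star, hq.isSelfAdjoint.star_eq] at h2
  rw [key g hg, mul_assoc, ← h2]

/-- In a von Neumann algebra, the annihilator projection of a set of operators is the projection
onto the closed span of their ranges. -/
theorem VonNeumannAlgebra.exists_annihilatorProjection {H : Type*} [NormedAddCommGroup H]
    [InnerProductSpace ℂ H] [CompleteSpace H] (N : VonNeumannAlgebra H) (T : Set (H →L[ℂ] H))
    (hT : ∀ u ∈ T, u ∈ N) : ∃ q ∈ N, IsStarProjection q ∧
      ∀ w : H →L[ℂ] H, (∀ u ∈ T, w * u = 0) ↔ w * q = 0 := by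
  let W : Submodule ℂ H := (⨆ u ∈ T, LinearMap.range (u : H →ₗ[ℂ] H)).topologicalClosure
  have hWc : IsClosed (W : Set H) := Submodule.isClosed_topologicalClosure _
  have : CompleteSpace W := hWc.completeSpace_coe
  have hW : ∀ u ∈ T, ∀ x, u x ∈ W := fun u hu x =>
    Submodule.le_topologicalClosure _
      (le_iSup₂ (f := fun (u : H →L[ℂ] H) (_ : u ∈ T) => LinearMap.range (u : H →ₗ[ℂ] H)) u hu
        ⟨x, rfl⟩)
  have hq : IsStarProjection W.starProjection := isStarProjection_starProjection
  have h : ∀ w : H →L[ℂ] H, (∀ u ∈ T, w * u = 0) ↔ w * W.starProjection = 0 := by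
    refine fun w => ⟨fun hw => ?_, fun hw u hu => ?_⟩
    · have hle : W ≤ LinearMap.ker (w : H →ₗ[ℂ] H) := by
        refine Submodule.topologicalClosure_minimal _ (iSup₂_le fun u hu => ?_) w.isClosed_ker
        rintro _ ⟨x, rfl⟩
        exact DFunLike.congr_fun (hw u hu) x
      ext x
      exact hle (W.starProjection_apply_mem x)
    · ext x
      have := DFunLike.congr_fun hw (u x)
      simpa [Submodule.starProjection_eq_self_iff.2 (hW u hu x)] using this
  refine ⟨W.starProjection, ?_, hq, h⟩
  -- By the double commutant property it suffices that the projection commutes with the commutant of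
  -- `N`.
  rw [← SetLike.mem_coe, ← N.centralizer_centralizer]
  intro g hg
  refine commute_annihilatorProjection hq h (fun u hu => (hg u (hT u hu)).symm) fun u hu => ?_
  have := congr_arg star (hg (star u) (star_mem (hT u hu)))
  simpa using this

theorem IsVonNeumann.hasAnnihilatorProjections {M : Type v} [CStarAlgebra M]
    (hM : IsVonNeumann M) : HasAnnihilatorProjections M := by
  obtain ⟨H, _, _, _, N, ⟨e⟩⟩ := hM
  intro T
  obtain ⟨q, hqN, hq, h⟩ := N.exists_annihilatorProjection ((fun u => (e u : H →L[ℂ] H)) '' T)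
    (by rintro _ ⟨u, -, rfl⟩; exact (e u).2)
  let q' : N.toStarSubalgebra := ⟨q, hqN⟩
  have hq' : IsStarProjection q' :=
    ⟨Subtype.ext hq.isIdempotentElem, Subtype.ext hq.isSelfAdjoint⟩
  refine ⟨e.symm q', ⟨?_, ?_⟩, fun w => ?_⟩
  · rw [IsIdempotentElem, ← map_mul, hq'.isIdempotentElem.eq]
  · rw [IsSelfAdjoint, ← map_star, hq'.isSelfAdjoint.star_eq]
  · have h1 : ∀ x y : M, x * y = 0 ↔ (e x : H →L[ℂ] H) * (e y : H →L[ℂ] H) = 0 := fun x y => by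
      rw [← MulMemClass.coe_mul, ← map_mul, ZeroMemClass.coe_eq_zero, map_eq_zero_iff e e.injective]
    simp only [h1, StarAlgEquiv.apply_symm_apply]
    exact (forall_mem_image (s := T) (f := fun u => (e u : H →L[ℂ] H))
      (p := fun u => (e w : H →L[ℂ] H) * u = 0)).symm.trans (h (e w))

/-- A projection `r` dominates `S` exactly when `1 - r` annihilates `S`, that is, when it
annihilates `q`. -/
theorem HasAnnihilatorProjections.exists_isProjectionLUB {M : Type v} [CStarAlgebra M]
    (hM : HasAnnihilatorProjections M) (S : Set M) (hS : ∀ p ∈ S, IsStarProjection p) :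
    ∃ q : M, IsProjectionLUB S q := by
  obtain ⟨q, hq, h⟩ := hM S
  refine ⟨q, hq, fun p hp => ?_, fun r hr hpr => ?_⟩
  · have := (h (1 - q)).2 (by rw [sub_mul, one_mul, hq.isIdempotentElem.eq, sub_self]) p hp
    rw [sub_mul, one_mul, sub_eq_zero] at this
    have h2 := congr_arg star this
    rw [star_mul, (hS p hp).isSelfAdjoint.star_eq, hq.isSelfAdjoint.star_eq] at h2
    exact h2.symm
  · have := (h (1 - r)).1 fun p hp => by
      have h2 := congr_arg star (hpr p hp)
      rw [star_mul, (hS p hp).isSelfAdjoint.star_eq, hr.isSelfAdjoint.star_eq] at h2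
      rw [sub_mul, one_mul, h2, sub_self]
    rw [sub_mul, one_mul, sub_eq_zero] at this
    have h2 := congr_arg star this
    rw [star_mul, hr.isSelfAdjoint.star_eq, hq.isSelfAdjoint.star_eq] at h2
    exact h2.symm

theorem IsCommutativeSubalg.topologicalClosure {M : Type v} [CStarAlgebra M]
    {D : NonUnitalStarSubalgebra ℂ M} (hD : IsCommutativeSubalg D) :
    IsCommutativeSubalg D.topologicalClosure := by
  have h1 : ∀ x ∈ D, ∀ y ∈ closure (D : Set M), x * y = y * x := fun x hx y hy =>
    closure_minimal (fun y hy => hD x hx y hy : (D : Set M) ⊆ {y | x * y = y * x})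
      (isClosed_eq (by fun_prop) (by fun_prop)) hy
  exact fun x hx y hy =>
    closure_minimal (fun x hx => h1 x hx y hy : (D : Set M) ⊆ {x | x * y = y * x})
      (isClosed_eq (by fun_prop) (by fun_prop)) hx

/-! ### Maximal commutative subalgebras are generated by projections -/

section Masa

variable {M : Type v} [CStarAlgebra M] {D : NonUnitalStarSubalgebra ℂ M}

theorem isClosed_of_maximal_commutative (hD : Maximal IsCommutativeSubalg D) :
    IsClosed (D : Set M) := by
  have : D.topologicalClosure ≤ D :=
    hD.2 hD.1.topologicalClosure D.le_topologicalClosure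
  exact isClosed_of_closure_subset this

/-- Adjoining `x` to `D` keeps it commutative; self-adjointness of `x` ensures that no new adjoint
has to be checked. -/
theorem mem_of_maximal_commutative (hD : Maximal IsCommutativeSubalg D) {x : M}
    (hx : IsSelfAdjoint x) (hc : ∀ d ∈ D, d * x = x * d) : x ∈ D := by
  have hs : ∀ a ∈ insert x (D : Set M), ∀ b ∈ insert x (D : Set M), a * b = b * a := by
    rintro a (rfl | ha) b (rfl | hb)
    · rfl
    · exact (hc b hb).symm
    · exact hc a ha
    · exact hD.1 a ha b hb
  have hstar : ∀ b ∈ insert x (D : Set M), star b ∈ insert x (D : Set M) := by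
    rintro b (rfl | hb)
    · exact .inl hx
    · exact .inr (star_mem hb)
  have hcomm := NonUnitalStarAlgebra.isMulCommutative_adjoin ℂ hs
    fun a ha b hb => hs a ha _ (hstar b hb)
  have hle : D ≤ NonUnitalStarAlgebra.adjoin ℂ (insert x (D : Set M)) := fun d hd =>
    NonUnitalStarAlgebra.subset_adjoin ℂ _ (.inr hd)
  refine hD.2 (fun a ha b hb => ?_) hle (NonUnitalStarAlgebra.subset_adjoin ℂ _ (.inl rfl))
  exact congr_arg Subtype.val (hcomm.is_comm.comm ⟨a, ha⟩ ⟨b, hb⟩)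

theorem real_smul_mem {x : M} (hx : x ∈ D) (r : ℝ) : r • x ∈ D := by
  rw [← Complex.coe_smul]
  exact SMulMemClass.smul_mem _ hx

attribute [local instance] CStarAlgebra.spectralOrder CStarAlgebra.spectralOrderedRing

/-- Halving the distance from a positive element to the combinations of projections. -/
theorem sub_smul_projection_bounds {a q : M} {c : ℝ} (h0 : 0 ≤ a) (h1 : a ≤ (2 * c) • (1 : M))
    (hq : IsStarProjection q) (hu : q * (a - c • (1 : M))⁺ = (a - c • (1 : M))⁺)
    (hv : (a - c • (1 : M))⁻ * q = 0) : 0 ≤ a - c • q ∧ a - c • q ≤ c • (1 : M) := by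
  have hsa : IsSelfAdjoint (a - c • (1 : M)) :=
    (IsSelfAdjoint.of_nonneg h0).sub ((IsSelfAdjoint.all c).smul (.one M))
  have hab := CFC.posPart_sub_negPart (a - c • (1 : M)) hsa
  have hup := CFC.posPart_nonneg (a - c • (1 : M))
  have hvp := CFC.negPart_nonneg (a - c • (1 : M))
  generalize (a - c • (1 : M))⁺ = u at *
  generalize (a - c • (1 : M))⁻ = w at *
  have ha : a = c • (1 : M) + (u - w) := by rw [hab]; abel
  have hu' : u * q = u := by
    have := congr_arg star hu
    rwa [star_mul, hq.isSelfAdjoint.star_eq, (IsSelfAdjoint.of_nonneg hup).star_eq] at this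
  have hv' : q * w = 0 := by
    have := congr_arg star hv
    rwa [star_mul, hq.isSelfAdjoint.star_eq, (IsSelfAdjoint.of_nonneg hvp).star_eq,
      star_zero] at this
  have hqq := hq.isIdempotentElem.eq
  constructor
  -- Here `q` carries the part of `a` above `c`. The lower bound comes from compressing `a` by `1 -
  -- q`, the upper one from compressing `2c - a` by `q`.
  · have h2 : 0 ≤ (1 - q) * a * (1 - q) := hq.one_sub.isSelfAdjoint.conjugate_nonneg h0
    have h3 : a - c • q = (1 - q) * a * (1 - q) + u := by
      rw [ha]
      simp only [mul_sub, sub_mul, mul_add, add_mul, mul_one, one_mul, smul_mul_assoc,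
        mul_smul_comm, hu, hu', hv, hv', hqq, zero_mul, smul_sub]
      abel
    rw [h3]
    exact add_nonneg h2 hup
  · have h2 : 0 ≤ q * ((2 * c) • (1 : M) - a) * q :=
      hq.isSelfAdjoint.conjugate_nonneg (sub_nonneg.2 h1)
    have h3 : c • (1 : M) - (a - c • q) = q * ((2 * c) • (1 : M) - a) * q + w := by
      rw [ha]
      simp only [mul_sub, sub_mul, mul_add, add_mul, mul_one, smul_mul_assoc,
        mul_smul_comm, hu, hu', hv', hqq, two_mul, add_smul, zero_mul]
      abel
    rw [← sub_nonneg, h3]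
    exact add_nonneg h2 hvp

/-- The projection is the annihilator projection of `(a - c)⁺`. It commutes with everything that
commutes with `a` in `D`, so maximality puts it in `D`. -/
theorem exists_projection_sub_bounds (hM : HasAnnihilatorProjections M)
    (hD : Maximal IsCommutativeSubalg D) {a : M} (haD : a ∈ D) {c : ℝ} (h0 : 0 ≤ a)
    (h1 : a ≤ (2 * c) • (1 : M)) :
    ∃ q ∈ D, IsStarProjection q ∧ 0 ≤ a - c • q ∧ a - c • q ≤ c • (1 : M) := by
  obtain ⟨q, hq, h⟩ := hM {(a - c • (1 : M))⁺}
  simp only [mem_singleton_iff, forall_eq] at h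
  have hcomm : ∀ d ∈ D, d * (a - c • (1 : M))⁺ = (a - c • (1 : M))⁺ * d := fun d hd => by
    have h2 : Commute (a - c • (1 : M)) d := by
      rw [commute_iff_eq, sub_mul, mul_sub, hD.1 a haD d hd]
      simp
    rw [CFC.posPart_def]
    exact (h2.cfcₙ_real _).eq.symm
  refine ⟨q, mem_of_maximal_commutative hD hq.isSelfAdjoint fun d hd => ?_, hq,
    sub_smul_projection_bounds h0 h1 hq ?_ ?_⟩
  · refine commute_annihilatorProjection hq (T := {(a - c • (1 : M))⁺}) (by simpa using h) ?_ ?_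
    · simpa using hcomm d hd
    · simpa using hcomm _ (star_mem hd)
  · have := (h (1 - q)).2 (by rw [sub_mul, one_mul, hq.isIdempotentElem.eq, sub_self])
    rw [sub_mul, one_mul, sub_eq_zero] at this
    exact this.symm
  · exact (h _).1 (CFC.negPart_mul_posPart _)

theorem HasAnnihilatorProjections.isGeneratedByProjections (hM : HasAnnihilatorProjections M)
    (hD : Maximal IsCommutativeSubalg D) : IsGeneratedByProjections D := by
  set P := NonUnitalStarAlgebra.adjoin ℂ {p : M | p ∈ D ∧ IsStarProjection p} with hP
  have hPD : P ≤ D := NonUnitalStarAlgebra.adjoin_le fun p hp => hp.1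
  have hDc := isClosed_of_maximal_commutative hD
  have hone : (1 : M) ∈ D := mem_of_maximal_commutative hD (.one M) (by simp)
  have hproj : ∀ q ∈ D, IsStarProjection q → q ∈ P := fun q h1 h2 =>
    NonUnitalStarAlgebra.subset_adjoin ℂ _ ⟨h1, h2⟩
  have honeP : (1 : M) ∈ P := hproj 1 hone ⟨one_mul 1, .one M⟩
  have hpos : ∀ a ∈ D, 0 ≤ a → a ∈ P.topologicalClosure := by
    intro a haD ha
    -- A binary expansion of `a`: `b` collects projections with weights `‖a‖ / 2 ^ k`, and each one
    -- halves the bound on the remainder.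
    have step : ∀ n : ℕ, ∃ b ∈ P, 0 ≤ a - b ∧ a - b ≤ (‖a‖ / 2 ^ n) • (1 : M) := by
      intro n
      induction n with
      | zero =>
        refine ⟨0, zero_mem P, by simpa using ha, ?_⟩
        have := IsSelfAdjoint.le_algebraMap_norm_self (IsSelfAdjoint.of_nonneg ha)
        simpa [Algebra.algebraMap_eq_smul_one] using this
      | succ n ih =>
        obtain ⟨b, hb, h0, h1⟩ := ih
        have hc : ‖a‖ / 2 ^ n = 2 * (‖a‖ / 2 ^ (n + 1)) := by rw [pow_succ]; field_simp
        rw [hc] at h1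
        obtain ⟨q, hqD, hq, h2, h3⟩ :=
          exists_projection_sub_bounds hM hD (sub_mem haD (hPD hb)) h0 h1
        refine ⟨b + (‖a‖ / 2 ^ (n + 1)) • q, add_mem hb (real_smul_mem (hproj q hqD hq) _), ?_, ?_⟩
        · rwa [← sub_sub]
        · rwa [← sub_sub]
    refine Metric.mem_closure_iff.2 fun ε hε => ?_
    have hlim : Tendsto (fun n : ℕ => ‖a‖ / 2 ^ n) atTop (𝓝 0) :=
      tendsto_const_nhds.div_atTop (tendsto_pow_atTop_atTop_of_one_lt one_lt_two)
    obtain ⟨n, hn⟩ := (hlim.eventually (gt_mem_nhds hε)).exists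
    obtain ⟨b, hb, h0, h1⟩ := step n
    refine ⟨b, hb, ?_⟩
    rw [dist_eq_norm]
    refine lt_of_le_of_lt ?_ hn
    rw [CStarAlgebra.norm_le_iff_le_algebraMap _ (by positivity) h0]
    rwa [Algebra.algebraMap_eq_smul_one]
  have hsa : ∀ a ∈ D, IsSelfAdjoint a → a ∈ P.topologicalClosure := by
    intro a haD ha
    have h1 := hpos (a + ‖a‖ • (1 : M)) (add_mem haD (real_smul_mem hone _)) (by
      have := IsSelfAdjoint.neg_algebraMap_norm_le_self ha
      rw [Algebra.algebraMap_eq_smul_one] at this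
      simpa using add_le_add_left this (‖a‖ • (1 : M)))
    have h2 : ‖a‖ • (1 : M) ∈ P.topologicalClosure :=
      real_smul_mem (P.le_topologicalClosure honeP) _
    simpa using sub_mem h1 h2
  refine le_antisymm (fun x hx => ?_) (P.topologicalClosure_minimal hPD hDc)
  have hre : (realPart x : M) ∈ D := by
    rw [realPart_apply_coe]
    exact real_smul_mem (add_mem hx (star_mem hx)) _
  have him : (imaginaryPart x : M) ∈ D := by
    rw [imaginaryPart_apply_coe]
    exact SMulMemClass.smul_mem _ (real_smul_mem (sub_mem hx (star_mem hx)) _)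
  rw [← realPart_add_I_smul_imaginaryPart x]
  exact add_mem (hsa _ hre (realPart x).2)
    (SMulMemClass.smul_mem _ (hsa _ him (imaginaryPart x).2))

end Masa

theorem IsVonNeumann.isAWStar {M : Type v} [CStarAlgebra M] (hM : IsVonNeumann M) : IsAWStar M :=
  ⟨hM.hasAnnihilatorProjections.exists_isProjectionLUB,
    fun _ hD => hM.hasAnnihilatorProjections.isGeneratedByProjections hD⟩

theorem exists_maximal_commutative {M : Type v} [CStarAlgebra M] {A : NonUnitalStarSubalgebra ℂ M}
    (hA : IsCommutativeSubalg A) : ∃ D, A ≤ D ∧ Maximal IsCommutativeSubalg D := by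
  refine zorn_le_nonempty₀ {D : NonUnitalStarSubalgebra ℂ M | IsCommutativeSubalg D}
    (fun c hc hchain y hy => ?_) A hA
  -- Two elements of the union of a chain lie in a common member, so the union generates a
  -- commutative algebra.
  have hdir : ∀ a ∈ ⋃ D ∈ c, (D : Set M), ∀ b ∈ ⋃ D ∈ c, (D : Set M), ∃ D ∈ c, a ∈ D ∧ b ∈ D := by
    intro a ha b hb
    simp only [mem_iUnion, exists_prop] at ha hb
    obtain ⟨D, hD, ha⟩ := ha
    obtain ⟨D', hD', hb⟩ := hb
    rcases hchain.total hD hD' with h | h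
    · exact ⟨D', hD', h ha, hb⟩
    · exact ⟨D, hD, ha, h hb⟩
  have hs : ∀ a ∈ ⋃ D ∈ c, (D : Set M), ∀ b ∈ ⋃ D ∈ c, (D : Set M), a * b = b * a := by
    intro a ha b hb
    obtain ⟨D, hD, h1, h2⟩ := hdir a ha b hb
    exact hc hD a h1 b h2
  have hcomm := NonUnitalStarAlgebra.isMulCommutative_adjoin ℂ hs fun a ha b hb => by
    obtain ⟨D, hD, h1, h2⟩ := hdir a ha b hb
    exact hc hD a h1 _ (star_mem h2)
  refine ⟨NonUnitalStarAlgebra.adjoin ℂ (⋃ D ∈ c, (D : Set M)), fun a ha b hb =>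
    congr_arg Subtype.val (hcomm.is_comm.comm ⟨a, ha⟩ ⟨b, hb⟩), fun D hD x hx => ?_⟩
  exact NonUnitalStarAlgebra.subset_adjoin ℂ _ (mem_biUnion hD hx)

theorem IsAWStar.hasEnoughProjections {M : Type v} [CStarAlgebra M] (hM : IsAWStar M) :
    HasEnoughProjections M := by
  intro A _ _ hA
  obtain ⟨D, hAD, hD⟩ := exists_maximal_commutative hA
  exact ⟨D, hD.1, hM.2 D hD, hAD⟩

/-! ### Bounded functions on a discrete set form a von Neumann algebra -/

section MultiplicationOperators

variable {S : Type v} [TopologicalSpace S]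

theorem norm_apply_mul_apply_le (f : S →ᵇ ℂ) (x : lp (fun _ : S => ℂ) 2) (s : S) :
    ‖f s * x s‖ ≤ ‖((‖f‖ : ℂ) • x) s‖ := by
  rw [lp.coeFn_smul, Pi.smul_apply, norm_smul, norm_mul, Complex.norm_real, norm_norm]
  exact mul_le_mul_of_nonneg_right (f.norm_coe_le_norm s) (norm_nonneg (x s))

/-- Multiplication of a square-summable family by a bounded function. -/
noncomputable def lpMul (f : S →ᵇ ℂ) (x : lp (fun _ : S => ℂ) 2) : lp (fun _ : S => ℂ) 2 :=
  ⟨fun s => f s * x s, (lp.memℓp ((‖f‖ : ℂ) • x)).mono' (norm_apply_mul_apply_le f x)⟩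

@[simp]
theorem lpMul_apply (f : S →ᵇ ℂ) (x : lp (fun _ : S => ℂ) 2) (s : S) :
    lpMul f x s = f s * x s := rfl

theorem norm_lpMul_le (f : S →ᵇ ℂ) (x : lp (fun _ : S => ℂ) 2) : ‖lpMul f x‖ ≤ ‖f‖ * ‖x‖ := by
  have : ‖lpMul f x‖ ≤ ‖(‖f‖ : ℂ) • x‖ :=
    lp.norm_mono (by norm_num) (norm_apply_mul_apply_le f x)
  rwa [norm_smul, Complex.norm_real, norm_norm] at this

/-- The multiplication operator of a bounded function. -/
noncomputable def mulOperator (f : S →ᵇ ℂ) :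
    lp (fun _ : S => ℂ) 2 →L[ℂ] lp (fun _ : S => ℂ) 2 :=
  LinearMap.mkContinuous
    { toFun := lpMul f
      map_add' := fun x y => by ext s; simp [mul_add]
      map_smul' := fun c x => by ext s; simp [mul_left_comm] } ‖f‖ (norm_lpMul_le f)

@[simp]
theorem mulOperator_apply (f : S →ᵇ ℂ) (x : lp (fun _ : S => ℂ) 2) (s : S) :
    mulOperator f x s = f s * x s := rfl

/-- The representation of bounded functions by multiplication operators. -/
noncomputable def mulOperatorHom :
    (S →ᵇ ℂ) →⋆ₐ[ℂ] (lp (fun _ : S => ℂ) 2 →L[ℂ] lp (fun _ : S => ℂ) 2) where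
  toFun := mulOperator
  map_one' := by ext x s; simp
  map_mul' f g := by ext x s; simp [mul_assoc]
  map_zero' := by ext x s; simp
  map_add' f g := by ext x s; simp [add_mul]
  commutes' c := by ext x s; simp
  map_star' f := by
    rw [ContinuousLinearMap.star_eq_adjoint, ContinuousLinearMap.eq_adjoint_iff]
    intro x y
    rw [lp.inner_eq_tsum, lp.inner_eq_tsum]
    refine tsum_congr fun s => ?_
    simp [mul_comm, mul_assoc]

theorem mulOperatorHom_apply (f : S →ᵇ ℂ) (x : lp (fun _ : S => ℂ) 2) (s : S) :
    mulOperatorHom f x s = f s * x s := rfl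

theorem mulOperatorHom_injective : Function.Injective (mulOperatorHom (S := S)) := by
  classical
  intro f g h
  ext s
  have h1 : mulOperatorHom f (lp.single 2 s 1) s = mulOperatorHom g (lp.single 2 s 1) s := by
    rw [h]
  simpa [mulOperatorHom_apply] using h1

/-- Commuting with the indicator of a point `s` forces `T x s = x s * T δₛ s`, so `T` multiplies by
its diagonal. Hence the multiplication operators contain their own commutant. -/
theorem mem_range_mulOperatorHom [DiscreteTopology S]
    {T : lp (fun _ : S => ℂ) 2 →L[ℂ] lp (fun _ : S => ℂ) 2}
    (hT : ∀ f : S →ᵇ ℂ, mulOperatorHom f * T = T * mulOperatorHom f) :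
    T ∈ (mulOperatorHom (S := S)).range := by
  classical
  refine ⟨BoundedContinuousFunction.ofNormedAddCommGroupDiscrete
    (fun s => T (lp.single 2 s 1) s) ‖T‖ fun s => ?_, ?_⟩
  · refine (lp.norm_apply_le_norm (by norm_num) _ s).trans ((T.le_opNorm _).trans ?_)
    rw [lp.norm_single (by norm_num)]
    simp
  · ext x s
    let χ : S →ᵇ ℂ := BoundedContinuousFunction.ofNormedAddCommGroupDiscrete
      (fun t => if t = s then 1 else 0) 1 fun t => by split_ifs <;> simp
    have hχ : mulOperatorHom χ x = x s • lp.single 2 s (1 : ℂ) := by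
      ext t
      rw [mulOperatorHom_apply]
      by_cases h : t = s
      · subst h; simp [χ]
      · simp [χ, h]
    have h1 : mulOperatorHom χ (T x) s = T (mulOperatorHom χ x) s := by
      rw [← mul_apply_eq_comp, hT χ, mul_apply_eq_comp]
    rw [hχ, map_smul, mulOperatorHom_apply] at h1
    have h2 : T x s = x s * T (lp.single 2 s 1) s := by simpa [χ] using h1
    exact (mul_comm _ _).trans h2.symm

variable (S) in
/-- The von Neumann algebra of multiplication operators. -/
noncomputable def mulOperatorAlgebra [DiscreteTopology S] :
    VonNeumannAlgebra (lp (fun _ : S => ℂ) 2) where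
  toStarSubalgebra := (mulOperatorHom (S := S)).range
  centralizer_centralizer' := by
    refine Subset.antisymm (fun T hT => ?_) Set.subset_centralizer_centralizer
    refine mem_range_mulOperatorHom fun f => hT _ ?_
    rintro _ ⟨g, rfl⟩
    change mulOperatorHom g * mulOperatorHom f = mulOperatorHom f * mulOperatorHom g
    rw [← map_mul, ← map_mul, mul_comm]

theorem isVonNeumann_boundedFunctions [DiscreteTopology S] : IsVonNeumann (S →ᵇ ℂ) :=
  ⟨lp (fun _ : S => ℂ) 2, inferInstance, inferInstance, inferInstance, mulOperatorAlgebra S,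
    ⟨StarAlgEquiv.ofInjective mulOperatorHom mulOperatorHom_injective⟩⟩

end MultiplicationOperators

/-! ### Testing projectivity on cubes -/

/-- Pullback of continuous functions on a compact space to bounded functions. -/
noncomputable def boundedPullback {S X : Type*} [TopologicalSpace S] [TopologicalSpace X]
    [CompactSpace X] (e : C(S, X)) : C(X, ℂ) →⋆ₐ[ℂ] (S →ᵇ ℂ) where
  toFun F := (BoundedContinuousFunction.mkOfCompact F).compContinuous e
  map_one' := by ext; simp
  map_mul' _ _ := by ext; simp
  map_zero' := by ext; simp
  map_add' _ _ := by ext; simp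
  commutes' _ := by ext; simp
  map_star' _ := by ext; simp

theorem boundedPullback_apply {S X : Type*} [TopologicalSpace S] [TopologicalSpace X]
    [CompactSpace X] (e : C(S, X)) (F : C(X, ℂ)) (s : S) :
    boundedPullback e F s = F (e s) := rfl

/-- Evaluation of all `[0,1]`-valued functions on `S`. -/
def evalCube (S : Type*) [TopologicalSpace S] [DiscreteTopology S] :
    C(S, (S → unitInterval) → unitInterval) :=
  ⟨fun s j => j s, continuous_of_discreteTopology⟩

/-- A bounded real function is an affine function of a `[0,1]`-valued function. -/
theorem exists_unitInterval_affine {S : Type*} (g : S → ℝ) {C : ℝ} (hg : ∀ s, |g s| ≤ C) :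
    ∃ (j : S → unitInterval) (R : ℝ), ∀ s, g s = 2 * R * j s - R := by
  -- The added `1` keeps the denominator `2 * R` positive even when `C = 0`.
  let R := |C| + 1
  have hR : 0 < R := by positivity
  have hgR : ∀ s, |g s| ≤ R := fun s => (hg s).trans ((le_abs_self C).trans (by simp [R]))
  refine ⟨fun s => ⟨(g s + R) / (2 * R), ?_, ?_⟩, R, fun s => ?_⟩
  · have := (abs_le.1 (hgR s)).1
    exact div_nonneg (by linarith) (by linarith)
  · have := (abs_le.1 (hgR s)).2
    exact (div_le_one (by linarith)).2 (by linarith)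
  · simp only
    field_simp
    ring

/-- The coordinate of the cube indexed by `j` restricts to `j` on `S`, so affine combinations of two
coordinates give the real and imaginary parts of any bounded function. -/
theorem boundedPullback_evalCube_surjective (S : Type*) [TopologicalSpace S]
    [DiscreteTopology S] : Function.Surjective (boundedPullback (evalCube S)) := by
  intro g
  obtain ⟨j, R, hj⟩ := exists_unitInterval_affine (fun s => (g s).re)
    fun s => (Complex.abs_re_le_norm _).trans (g.norm_coe_le_norm s)
  obtain ⟨k, R', hk⟩ := exists_unitInterval_affine (fun s => (g s).im)
    fun s => (Complex.abs_im_le_norm _).trans (g.norm_coe_le_norm s)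
  refine ⟨⟨fun q => ((2 * R * q j - R : ℝ) : ℂ) + ((2 * R' * q k - R' : ℝ) : ℂ) * Complex.I,
    by fun_prop⟩, ?_⟩
  ext s
  rw [boundedPullback_apply]
  change ((2 * R * j s - R : ℝ) : ℂ) + ((2 * R' * k s - R' : ℝ) : ℂ) * Complex.I = g s
  rw [← hj, ← hk, Complex.re_add_im]

/-- Unital `⋆`-homomorphisms between algebras of continuous functions come from continuous maps. -/
theorem exists_continuousMap_of_starAlgHom {X K : Type*} [TopologicalSpace X] [CompactSpace X]
    [TopologicalSpace K] [CompactSpace K] [T2Space K] (ψ : C(K, ℂ) →⋆ₐ[ℂ] C(X, ℂ)) :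
    ∃ θ : C(X, K), ∀ f x, ψ f x = f (θ x) := by
  let h := WeakDual.CharacterSpace.homeoEval K ℂ
  refine ⟨(h.symm : C(_, K)).comp ((WeakDual.CharacterSpace.compContinuousMap ψ).comp
    (WeakDual.CharacterSpace.continuousMapEval X ℂ)), fun f x => ?_⟩
  set χ := WeakDual.CharacterSpace.compContinuousMap ψ
    (WeakDual.CharacterSpace.continuousMapEval X ℂ x)
  have h1 : (h (h.symm χ)) f = χ f := by rw [h.apply_symm_apply]
  exact h1.symm

/-- For empty `K`, lifting the map into the zero algebra along `ℂ → 0` would give a map from a point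
to `K`. -/
theorem nonempty_of_isProjectiveFor {K : Type u} [MetricSpace K] [CompactSpace K]
    (hK : IsProjectiveFor.{u, v} AnyCStar IsVonNeumann C(K, ℂ)) : Nonempty K := by
  by_contra hne
  rw [not_nonempty_iff] at hne
  let π : C(PUnit.{v + 1}, ℂ) →⋆ₐ[ℂ] (PEmpty.{v + 1} →ᵇ ℂ) :=
    boundedPullback ⟨fun s => s.elim, by fun_prop⟩
  let φ : C(K, ℂ) →⋆ₐ[ℂ] (PEmpty.{v + 1} →ᵇ ℂ) := boundedPullback ⟨fun s => s.elim, by fun_prop⟩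
  obtain ⟨ψ, -⟩ := hK C(PUnit.{v + 1}, ℂ) (PEmpty.{v + 1} →ᵇ ℂ) trivial
    isVonNeumann_boundedFunctions π (fun g => ⟨0, by ext s; exact s.elim⟩) φ
  obtain ⟨θ, -⟩ := exists_continuousMap_of_starAlgHom ψ
  exact hne.elim (θ PUnit.unit)

theorem connected_locallyPathConnected_of_isProjectiveFor {K : Type u} [MetricSpace K]
    [CompactSpace K] (hK : IsProjectiveFor.{u, v} AnyCStar IsVonNeumann C(K, ℂ)) :
    ConnectedSpace K ∧ LocallyPathConnectedSpace K := by
  have hne := nonempty_of_isProjectiveFor hK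
  let S := ULift.{v} ℕ
  let d : C(S, K) := ⟨fun s => TopologicalSpace.denseSeq K s.down, continuous_of_discreteTopology⟩
  obtain ⟨ψ, hψ⟩ := hK C((S → unitInterval) → unitInterval, ℂ) (S →ᵇ ℂ) trivial
    isVonNeumann_boundedFunctions (boundedPullback (evalCube S))
    (boundedPullback_evalCube_surjective S) (boundedPullback d)
  obtain ⟨θ, hθ⟩ := exists_continuousMap_of_starAlgHom ψ
  have hd : ∀ s : S, θ (evalCube S s) = d s := fun s => by
    by_contra hne
    -- Comparing the lift with `φ` on the distance to `d s` shows that this distance vanishes at `θ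
    -- (evalCube S s)`.
    let f : C(K, ℂ) := ⟨fun k => (dist k (d s) : ℂ), by fun_prop⟩
    have h1 : boundedPullback (evalCube S) (ψ f) s = boundedPullback d f s :=
      DFunLike.congr_fun (DFunLike.congr_fun hψ f) s
    rw [boundedPullback_apply, boundedPullback_apply, hθ] at h1
    exact hne (by simpa [f] using h1)
  -- The image is compact and contains a dense sequence.
  have hsurj : Function.Surjective θ := by
    rw [← range_eq_univ, ← (isCompact_range θ.continuous).isClosed.closure_eq]
    refine Dense.closure_eq ((TopologicalSpace.denseRange_denseSeq K).mono ?_)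
    rintro _ ⟨n, rfl⟩
    exact ⟨_, hd ⟨n⟩⟩
  exact ⟨connectedSpace_of_surjective θ hsurj, locallyPathConnectedSpace_of_surjective θ hsurj⟩

/-! ### Reduction to countably many generators -/

/-- Elements of the closed `⋆`-subalgebra generated by `S` are in the one generated by a countable
subset of `S`. -/
theorem exists_countable_mem_closure_adjoin {M : Type*} [CStarAlgebra M] {S : Set M} {x : M}
    (hx : x ∈ (NonUnitalStarAlgebra.adjoin ℂ S).topologicalClosure) :
    ∃ C ⊆ S, C.Countable ∧ x ∈ (NonUnitalStarAlgebra.adjoin ℂ C).topologicalClosure := by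
  have h1 : ∀ y ∈ NonUnitalStarAlgebra.adjoin ℂ S,
      ∃ C ⊆ S, C.Countable ∧ y ∈ NonUnitalStarAlgebra.adjoin ℂ C := by
    intro y hy
    induction hy using NonUnitalStarAlgebra.adjoin_induction with
    | mem y hy =>
      exact ⟨{y}, by simpa using hy, countable_singleton y,
        NonUnitalStarAlgebra.subset_adjoin ℂ _ rfl⟩
    | zero => exact ⟨∅, empty_subset _, countable_empty, zero_mem _⟩
    | add y z _ _ ihy ihz =>
      obtain ⟨C, hC, hc, h⟩ := ihy
      obtain ⟨C', hC', hc', h'⟩ := ihz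
      exact ⟨C ∪ C', union_subset hC hC', hc.union hc', add_mem
        (NonUnitalStarAlgebra.adjoin_mono subset_union_left h)
        (NonUnitalStarAlgebra.adjoin_mono subset_union_right h')⟩
    | mul y z _ _ ihy ihz =>
      obtain ⟨C, hC, hc, h⟩ := ihy
      obtain ⟨C', hC', hc', h'⟩ := ihz
      exact ⟨C ∪ C', union_subset hC hC', hc.union hc', mul_mem
        (NonUnitalStarAlgebra.adjoin_mono subset_union_left h)
        (NonUnitalStarAlgebra.adjoin_mono subset_union_right h')⟩
    | smul r y _ ih =>
      obtain ⟨C, hC, hc, h⟩ := ih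
      exact ⟨C, hC, hc, SMulMemClass.smul_mem r h⟩
    | star y _ ih =>
      obtain ⟨C, hC, hc, h⟩ := ih
      exact ⟨C, hC, hc, star_mem h⟩
  obtain ⟨y, hy, hlim⟩ := mem_closure_iff_seq_limit.1 hx
  choose C hCS hC hyC using fun n => h1 (y n) (hy n)
  refine ⟨⋃ n, C n, iUnion_subset hCS, countable_iUnion hC, mem_closure_of_tendsto hlim ?_⟩
  exact Eventually.of_forall fun n =>
    NonUnitalStarAlgebra.adjoin_mono (subset_iUnion C n) (hyC n)

theorem exists_countable_le_closure_adjoin {M : Type*} [CStarAlgebra M] {S : Set M}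
    {A : NonUnitalStarSubalgebra ℂ M} (hA : TopologicalSpace.IsSeparable (A : Set M))
    (hAS : A ≤ (NonUnitalStarAlgebra.adjoin ℂ S).topologicalClosure) :
    ∃ C ⊆ S, C.Countable ∧ A ≤ (NonUnitalStarAlgebra.adjoin ℂ C).topologicalClosure := by
  obtain ⟨t, htA, htc, hAt⟩ := hA.exists_countable_dense_subset
  choose! C hCS hC hmem using fun x (hx : x ∈ t) =>
    exists_countable_mem_closure_adjoin (hAS (htA hx))
  refine ⟨⋃ x ∈ t, C x, iUnion₂_subset hCS, htc.biUnion hC, fun x hx => ?_⟩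
  refine closure_minimal (fun y hy => ?_)
    (NonUnitalStarSubalgebra.isClosed_topologicalClosure _) (hAt hx)
  exact closure_mono (NonUnitalStarAlgebra.adjoin_mono (subset_biUnion_of_mem hy)) (hmem y hy)

/-! ### Embedding the spectrum in the interval -/

section CommutativeCase

variable {N : Type*} [CommCStarAlgebra N]

theorem eq_of_forall_character {a b : N} (h : ∀ x : characterSpace ℂ N, x a = x b) : a = b :=
  (gelfandTransform_isometry N).injective (ContinuousMap.ext h)

theorem character_projection_eq {p : N} (hp : IsStarProjection p) (x : characterSpace ℂ N) :
    x p = 0 ∨ x p = 1 := by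
  have h : x p * x p = x p := by rw [← map_mul, hp.isIdempotentElem.eq]
  rcases eq_or_ne (x p) 0 with h0 | h0
  · exact .inl h0
  · exact .inr (mul_right_cancel₀ h0 (by rw [h, one_mul]))

open Classical in
/-- The values of a character at a sequence of projections, as binary digits. -/
noncomputable def characterDigits (p : ℕ → N) (x : characterSpace ℂ N) (n : ℕ) : Bool :=
  decide (x (p n) = 1)

/-- The element with ternary digits given by a sequence of projections. -/
noncomputable def ternarySum (p : ℕ → N) : N := ∑' n, ((1 / 3 : ℝ) ^ n : ℂ) • p n

/-- A character takes the values `0` and `1` on projections, so it turns the series into a Cantor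
function. Ratio `1/3 < 1/2` makes that function injective in the digits. -/
theorem character_ternarySum {p : ℕ → N} (hp : ∀ n, IsStarProjection (p n))
    (x : characterSpace ℂ N) :
    x (ternarySum p) = (Cardinal.cantorFunction (1 / 3) (characterDigits p x) : ℂ) := by
  have hs : Summable fun n => ((1 / 3 : ℝ) ^ n : ℂ) • p n := by
    refine Summable.of_norm_bounded
      (summable_geometric_of_lt_one (by norm_num : (0 : ℝ) ≤ 1 / 3) (by norm_num)) fun n => ?_
    rw [norm_smul, norm_pow, Complex.norm_real, Real.norm_of_nonneg (by norm_num)]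
    exact mul_le_of_le_one_right (by positivity) (hp n).norm_le
  rw [ternarySum, (hs.map_tsum x (map_continuous x)), Cardinal.cantorFunction, Complex.ofReal_tsum]
  refine tsum_congr fun n => ?_
  rw [map_smul]
  rcases character_projection_eq (hp n) x with h | h <;>
    simp [Cardinal.cantorFunctionAux, characterDigits, h]

/-- The largest sum is `3/2`, so halving is enough to land in `[0,1]`. -/
theorem cantorFunction_third_mem (d : ℕ → Bool) :
    Cardinal.cantorFunction (1 / 3) d / 2 ∈ Icc (0 : ℝ) 1 := by
  constructor
  · exact div_nonneg (tsum_nonneg fun n => Cardinal.cantorFunctionAux_nonneg (by norm_num))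
      (by norm_num)
  · have h := Cardinal.cantorFunction_le (c := 1 / 3) (f := d) (g := fun _ => true) (by norm_num)
      (by norm_num) (fun _ _ => rfl)
    have h2 : Cardinal.cantorFunction (1 / 3) (fun _ => true) = 3 / 2 := by
      simp only [Cardinal.cantorFunction, Cardinal.cantorFunctionAux, cond_true]
      rw [tsum_geometric_of_lt_one (by norm_num) (by norm_num)]
      norm_num
    rw [h2] at h
    linarith

/-- The real part, halved and clamped to `[0,1]`. -/
noncomputable def halfClamp : C(ℂ, unitInterval) :=
  ⟨fun z => projIcc 0 1 zero_le_one (z.re / 2), continuous_projIcc.comp (by fun_prop)⟩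

theorem coe_halfClamp_character {p : ℕ → N} (hp : ∀ n, IsStarProjection (p n))
    (x : characterSpace ℂ N) : (halfClamp (x (ternarySum p)) : ℝ) =
      Cardinal.cantorFunction (1 / 3) (characterDigits p x) / 2 := by
  rw [character_ternarySum hp]
  exact congr_arg Subtype.val
    (projIcc_of_mem zero_le_one (cantorFunction_third_mem (characterDigits p x)))

/-- If characters of `N` are determined by their values on a sequence of projections, then every
homomorphism from `C(K)` to `N` is given by functional calculus at a self-adjoint element. -/
theorem exists_starAlgHom_eq_cfc {K : Type*} [MetricSpace K] [CompactSpace K]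
    (hK : ∀ E : Set unitInterval, IsClosed E →
      ∀ f : C(E, K), ∃ g : C(unitInterval, K), ∀ x : E, g x = f x)
    {p : ℕ → N} (hp : ∀ n, IsStarProjection (p n))
    (hsep : ∀ x y : characterSpace ℂ N, (∀ n, x (p n) = y (p n)) → x = y)
    (φ : C(K, ℂ) →⋆ₐ[ℂ] N) :
    ∃ a : N, IsSelfAdjoint a ∧ ∃ G : C(ℂ, K), ∀ f, φ f = cfc (fun z => f (G z)) a := by
  have hsa : IsSelfAdjoint (ternarySum p) := eq_of_forall_character fun x => by
    rw [map_star, character_ternarySum hp]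
    exact Complex.conj_ofReal _
  let τ : characterSpace ℂ N → unitInterval := fun x => halfClamp (x (ternarySum p))
  have hτc : Continuous τ :=
    halfClamp.continuous.comp (gelfandTransform ℂ N (ternarySum p)).continuous
  have hτi : Function.Injective τ := by
    intro x y hxy
    have h1 := congr_arg Subtype.val hxy
    simp only [τ, coe_halfClamp_character hp] at h1
    have h2 := Cardinal.cantorFunction_injective (c := 1 / 3) (by norm_num) (by norm_num)
      ((div_left_inj' two_ne_zero).1 h1)
    refine hsep x y fun n => ?_
    have h3 := congr_fun h2 n
    simp only [characterDigits, decide_eq_decide] at h3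
    rcases character_projection_eq (hp n) x with hx | hx <;>
      rcases character_projection_eq (hp n) y with hy | hy <;> simp_all
  have hτ : IsClosedEmbedding τ := hτc.isClosedEmbedding hτi
  obtain ⟨θ, hθ⟩ := exists_continuousMap_of_starAlgHom
    ((gelfandStarTransform N : N →⋆ₐ[ℂ] C(characterSpace ℂ N, ℂ)).comp φ)
  let e := hτ.isEmbedding.toHomeomorph
  -- The map `θ` dual to `φ` is transported to the closed set `range τ` and extended to the whole
  -- interval.
  obtain ⟨g, hg⟩ := hK (range τ) hτ.isClosed_range (θ.comp (e.symm : C(range τ, _)))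
  refine ⟨ternarySum p, hsa, g.comp halfClamp, fun f => eq_of_forall_character fun x => ?_⟩
  have h1 : x (φ f) = f (θ x) := hθ f x
  have h2 : g (τ x) = θ x := (hg (e x)).trans (congr_arg θ (e.symm_apply_apply x))
  have hn : IsStarNormal (ternarySum p) := hsa.isStarNormal
  rw [h1, StarAlgHomClass.map_cfc (R := ℂ) (S := ℂ) x (fun z => f (g.comp halfClamp z))
    (ternarySum p) (by fun_prop) (map_continuous x)]
  have h3 := cfc_algebraMap (R := ℂ) (A := ℂ) (p := IsStarNormal) (x (ternarySum p))
    (fun z => f (g.comp halfClamp z))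
  rw [Algebra.algebraMap_self, RingHom.id_apply, RingHom.id_apply] at h3
  rw [h3, ContinuousMap.comp_apply]
  exact congr_arg f h2.symm

end CommutativeCase

/-! ### Lifting through functional calculus -/

/-- Homomorphisms given by functional calculus at a self-adjoint element lift along surjections. -/
theorem exists_lift_of_eq_cfc {K : Type*} [TopologicalSpace K] {B M : Type*} [CStarAlgebra B]
    [CStarAlgebra M] (π : B →⋆ₐ[ℂ] M) (hπ : Function.Surjective π) (φ : C(K, ℂ) →⋆ₐ[ℂ] M) {a : M}
    (ha : IsSelfAdjoint a) (G : C(ℂ, K)) (hφ : ∀ f, φ f = cfc (fun z => f (G z)) a) :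
    ∃ ψ : C(K, ℂ) →⋆ₐ[ℂ] B, π.comp ψ = φ := by
  obtain ⟨c, rfl⟩ := hπ a
  let b : B := realPart c
  have hb : IsSelfAdjoint b := (realPart c).2
  have hπb : π b = π c := by
    simp only [b, realPart_apply_coe]
    rw [← Complex.coe_smul, map_smul, map_add, map_star, ha.star_eq, ← two_smul ℂ, smul_smul]
    simp
  have hbn : IsStarNormal b := hb.isStarNormal
  -- The spectrum of `b` may exceed that of `π b`; this is harmless because `G` is defined on all of
  -- `ℂ`.
  let G' : C(spectrum ℂ b, K) := G.comp ⟨Subtype.val, continuous_subtype_val⟩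
  refine ⟨(cfcHom (R := ℂ) (p := IsStarNormal) hbn).comp (ContinuousMap.compStarAlgHom' ℂ ℂ G'),
    StarAlgHom.ext fun f => ?_⟩
  have h1 : cfc (fun z => f (G z)) b =
      cfcHom (R := ℂ) (p := IsStarNormal) hbn (ContinuousMap.compStarAlgHom' ℂ ℂ G' f) :=
    cfc_apply (fun z => f (G z)) b hbn (by fun_prop)
  have hn : IsStarNormal (π b) := by rw [hπb]; exact ha.isStarNormal
  rw [StarAlgHom.comp_apply, StarAlgHom.comp_apply, ← h1, hφ, ← hπb]
  exact π.map_cfc (fun z => f (G z)) b (by fun_prop) (map_continuous π) hbn hn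

/-- The commutative C⋆-algebra structure on the closed `⋆`-subalgebra generated by commuting
self-adjoint elements. -/
@[reducible]
noncomputable def commCStarAlgebraClosureAdjoin {M : Type*} [CStarAlgebra M] {s : Set M}
    (hs : ∀ x ∈ s, ∀ y ∈ s, x * y = y * x) (hsa : ∀ x ∈ s, IsSelfAdjoint x) :
    CommCStarAlgebra (StarAlgebra.adjoin ℂ s).topologicalClosure :=
  have hc : IsClosed ((StarAlgebra.adjoin ℂ s).topologicalClosure : Set M) :=
    StarSubalgebra.isClosed_topologicalClosure _
  have hm : IsMulCommutative (StarAlgebra.adjoin ℂ s) :=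
    StarAlgebra.isMulCommutative_adjoin ℂ hs fun a ha b hb => by
      rw [(hsa b hb).star_eq]; exact hs a ha b hb
  { StarSubalgebra.cstarAlgebra (StarAlgebra.adjoin ℂ s).topologicalClosure (h_closed := hc) with
    mul_comm := (StarSubalgebra.commRingTopologicalClosure (StarAlgebra.adjoin ℂ s)
      hm.is_comm.comm).mul_comm }

theorem isProjectiveFor_hasEnoughProjections {K : Type u} [MetricSpace K] [CompactSpace K]
    (hK : ∀ E : Set unitInterval, IsClosed E →
      ∀ f : C(E, K), ∃ g : C(unitInterval, K), ∀ x : E, g x = f x) :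
    IsProjectiveFor.{u, v} AnyCStar HasEnoughProjections C(K, ℂ) := by
  intro B M _ _ _ hM π hπ φ
  let A : NonUnitalStarSubalgebra ℂ M := (NonUnitalStarAlgHom.range φ).topologicalClosure
  have hAsep : TopologicalSpace.IsSeparable (A : Set M) := by
    have h : TopologicalSpace.IsSeparable (range φ) :=
      TopologicalSpace.isSeparable_range (map_continuous φ)
    exact h.closure
  have hAcomm : IsCommutativeSubalg A := by
    refine IsCommutativeSubalg.topologicalClosure ?_
    rintro _ ⟨f, rfl⟩ _ ⟨g, rfl⟩
    change φ f * φ g = φ g * φ f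
    rw [← map_mul, ← map_mul, mul_comm]
  obtain ⟨D, hDcomm, hDgen, hAD⟩ :=
    hM A (NonUnitalStarSubalgebra.isClosed_topologicalClosure _) hAsep hAcomm
  obtain ⟨C, hCD, hC, hAC⟩ := exists_countable_le_closure_adjoin hAsep (hAD.trans hDgen.le)
  -- Inserting `0` makes the countable set nonempty, so that a sequence enumerates it.
  obtain ⟨p, hp⟩ := (hC.insert 0).exists_eq_range (insert_nonempty 0 C)
  have hpD : ∀ n, p n ∈ D ∧ IsStarProjection (p n) := fun n => by
    have h : p n ∈ insert 0 C := hp ▸ mem_range_self n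
    rcases h with h | h
    · rw [h]; exact ⟨zero_mem D, IsStarProjection.zero M⟩
    · exact hCD h
  -- The unital algebra is taken so that `φ` stays unital when its codomain is restricted.
  let S := StarAlgebra.adjoin ℂ (range p)
  let N := S.topologicalClosure
  let _ : CommCStarAlgebra N := commCStarAlgebraClosureAdjoin
    (by rintro _ ⟨n, rfl⟩ _ ⟨m, rfl⟩; exact hDcomm _ (hpD n).1 _ (hpD m).1)
    (by rintro _ ⟨n, rfl⟩; exact (hpD n).2.isSelfAdjoint)
  have hpN : ∀ n, p n ∈ N := fun n =>
    S.le_topologicalClosure (StarAlgebra.subset_adjoin ℂ _ (mem_range_self n))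
  have hφN : ∀ f, φ f ∈ N := by
    have hle : (NonUnitalStarAlgebra.adjoin ℂ C).topologicalClosure ≤
        N.toNonUnitalStarSubalgebra := by
      refine NonUnitalStarSubalgebra.topologicalClosure_minimal _
        (NonUnitalStarAlgebra.adjoin_le fun c hc => ?_) (S.isClosed_topologicalClosure)
      obtain ⟨n, rfl⟩ : c ∈ range p := hp ▸ mem_insert_of_mem 0 hc
      exact hpN n
    exact fun f => hle (hAC (NonUnitalStarSubalgebra.le_topologicalClosure _ ⟨f, rfl⟩))
  let φ' : C(K, ℂ) →⋆ₐ[ℂ] N := φ.codRestrict N hφN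
  let p' : ℕ → N := fun n => ⟨p n, hpN n⟩
  have hp' : ∀ n, IsStarProjection (p' n) := fun n =>
    ⟨Subtype.ext (hpD n).2.isIdempotentElem, Subtype.ext (hpD n).2.isSelfAdjoint⟩
  have hsep : ∀ x y : characterSpace ℂ N, (∀ n, x (p' n) = y (p' n)) → x = y := by
    intro x y hxy
    refine StarAlgHomClass.ext_topologicalClosure (R := ℂ) (map_continuous x) (map_continuous y)
      fun z => ?_
    refine StarAlgebra.adjoin_induction_subtype z ?_ ?_ ?_ ?_ ?_
    · rintro _ ⟨n, rfl⟩; exact hxy n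
    · intro r; exact (AlgHomClass.commutes x r).trans (AlgHomClass.commutes y r).symm
    · intro a b ha hb; simp only [map_add, ha, hb]
    · intro a b ha hb; simp only [map_mul, ha, hb]
    · intro a ha; simp only [map_star, ha]
  obtain ⟨a, ha, G, hG⟩ := exists_starAlgHom_eq_cfc hK hp' hsep φ'
  have han : IsStarNormal a := ha.isStarNormal
  have haM : IsSelfAdjoint (N.subtype a) := ha.map N.subtype
  refine exists_lift_of_eq_cfc π hπ φ haM G fun f => ?_
  rw [← N.subtype.map_cfc (fun z => f (G z)) a (by fun_prop) continuous_subtype_val han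
    haM.isStarNormal, ← hG]
  rfl

theorem IsProjectiveFor.mono {𝒳 𝒴 𝒴' : ∀ (B : Type v) [CStarAlgebra B], Prop}
    {A : Type u} [CStarAlgebra A] (h : ∀ (M : Type v) [CStarAlgebra M], 𝒴' M → 𝒴 M)
    (hA : IsProjectiveFor.{u, v} 𝒳 𝒴 A) : IsProjectiveFor.{u, v} 𝒳 𝒴' A :=
  fun B M _ _ hB hM => hA B M hB (h M hM)

end

theorem theorem3p3 (K : Type u) [MetricSpace K] [CompactSpace K] :
    List.TFAE [
      IsProjectiveFor.{u, v} AnyCStar IsVonNeumann C(K, ℂ),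
      IsProjectiveFor.{u, v} AnyCStar IsAWStar C(K, ℂ),
      IsProjectiveFor.{u, v} AnyCStar HasEnoughProjections C(K, ℂ),
      ∃ f : C(unitInterval, K), Function.Surjective f,
      ConnectedSpace K ∧ LocallyPathConnectedSpace K,
      ∀ E : Set unitInterval, IsClosed E →
        ∀ f : C(E, K), ∃ g : C(unitInterval, K), ∀ x : E, g x = f x,
      ∀ E : Set unitInterval, IsClosed E → (∀ x ∈ E, (x : ℝ) ∈ cantorSet) →
        ∀ f : C(E, K), ∃ g : C(unitInterval, K), ∀ x : E, g x = f x] := by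
  tfae_have 1 → 5 := connected_locallyPathConnected_of_isProjectiveFor
  tfae_have 2 → 1 := IsProjectiveFor.mono fun M _ hM => IsVonNeumann.isAWStar hM
  tfae_have 3 → 2 := IsProjectiveFor.mono fun M _ hM => IsAWStar.hasEnoughProjections hM
  tfae_have 6 → 3 := isProjectiveFor_hasEnoughProjections
  have : LocallyPathConnectedSpace unitInterval :=
    (convex_Icc (0 : ℝ) 1).locallyPathConnectedSpace
  tfae_have 4 → 5 := fun ⟨f, hf⟩ =>
    ⟨connectedSpace_of_surjective f hf, locallyPathConnectedSpace_of_surjective f hf⟩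
  tfae_have 5 → 6 := by
    rintro ⟨_, _⟩ E hE f
    exact exists_extension_unitInterval hE f
  tfae_have 6 → 7 := fun h E hE _ => h E hE
  tfae_have 7 → 4 := exists_surjective_of_cantorSet_extension
  tfae_finish
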